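/- Let $D\in\mathbb N$, and let $(X,\xi)\sim P\otimes\mathcal N(0,\mathbf I_D)$ be random vectors in $\mathbb R^D$, where $P$ is a probability measure with a density $\pi$ with respect to Lebesgue measure. Let $M\in\mathbb R$ and $\mathfrak D\ge 0$, and suppose that - $\pi$ is $M$-semi-log-concave, i.e. $x\mapsto-\log\pi(x)+\frac M2\|x\|^2$ is convex on $\mathbb R^D$ as a function with values in $(-\infty,+\infty]$ (equal to $+\infty$ where $\pi=0$); - the support of $P$ is bounded, with $\operatorname{diam}(\operatorname{supp}P)\le 2\mathfrak D$ (Euclidean distance). Let $\sigma>0$ and $Y=X+\sigma\xi$. Then $$\operatorname{Var}\big(X\,\big|\,X+\sigma\xi=y\big)\preccurlyeq\Big(\mathfrak D^2\wedge\frac{\sigma^2}{(1-M\sigma^2)_+}\Big)\mathbf I_D ,$$ where $\preccurlyeq$ is the order of symmetric matrices ($A\preccurlyeq B$ means that $B-A$ is positive semidefinite), $a\wedge b=\min(a,b)$, $a_+=\max(a,0)$, and $\sigma^2/0=+\infty$, so that the bound is $\mathfrak D^2$ when $M\sigma^2\ge1$. The left-hand side is the covariance matrix of the conditional law of $X$ given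 $Y=y$. The inequality holds for almost every $y$ (with respect to the law of $Y$) for the regular conditional law of $X$ given $Y$. Moreover, that law coincides, for almost every $y$, with the probability measure whose density with respect to $P$ is proportional to $x\mapsto\exp\big(-\|y-x\|^2/(2\sigma^2)\big)$, and for this version the inequality holds for every $y\in\mathbb R^D$. -/

import Mathlib

open MeasureTheory ProbabilityTheory
open scoped MatrixOrder

/-- A nonnegative function `p` on `ℝ^D` is `M`-semi-log-concave if the extended-valued function
`x ↦ -log p(x) + (M/2) ‖x‖²`, which is `+∞` where `p` vanishes, is convex on `ℝ^D`: its effective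
domain `{x | 0 < p x}` is convex and the function is convex there. -/
structure IsSemiLogConcave {D : ℕ} (M : ℝ) (p : EuclideanSpace ℝ (Fin D) → ℝ) : Prop where
  nonneg : ∀ x, 0 ≤ p x
  convexOn : ConvexOn ℝ {x | 0 < p x} (fun x => -Real.log (p x) + M / 2 * ‖x‖ ^ 2)

/-- The covariance matrix of a measure on `ℝ^D`. -/
noncomputable def covMat {D : ℕ} (ν : Measure (EuclideanSpace ℝ (Fin D))) :
    Matrix (Fin D) (Fin D) ℝ :=
  Matrix.of fun i j => cov[fun x => x i, fun x => x j; ν]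

/-- The law on `ℝ^D` whose density with respect to `P` is proportional to
`x ↦ exp (-‖y - x‖² / (2 σ²))`. This is Bayes' formula for the conditional law of `X` given
`X + σ ξ = y`, when `(X, ξ) ∼ P ⊗ N(0, I)`; it is defined at every point `y`. -/
noncomputable def gaussianPosterior {D : ℕ} (P : Measure (EuclideanSpace ℝ (Fin D))) (σ : ℝ)
    (y : EuclideanSpace ℝ (Fin D)) : Measure (EuclideanSpace ℝ (Fin D)) :=
  P.tilted fun x => -‖y - x‖ ^ 2 / (2 * σ ^ 2)

/-- The number `R² ∧ σ² / (1 - M σ²)₊`, where a quotient with denominator `0` is `+∞`. -/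
noncomputable def semiLogConcaveBound (R M σ : ℝ) : ℝ :=
  if M * σ ^ 2 < 1 then min (R ^ 2) (σ ^ 2 / (1 - M * σ ^ 2)) else R ^ 2

/-!
The posterior law of `X` given `X + σ ξ = y` has Lebesgue density proportional to
`q x = p x * exp (-‖y - x‖² / (2 σ²))`. Since `p` is `M`-semi-log-concave, the parallelogram law
shows that `q` is strongly log-concave with constant `k = 1 / σ² - M` when `M σ² < 1`
(`IsSemiLogConcave.mul_le`, `gaussianWeight_mul`), so the bound `σ² / (1 - M σ²) = 1 / k` is the
Brascamp–Lieb inequality for linear functionals (`variance_inner_le_of_strongly_logConcave`).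

For a linear functional `L = ⟪v, ·⟫` that inequality follows directly from the Prékopa–Leindler
inequality with weights `1/2`: applied to the functions `q exp (t L)`, `q exp (-t L)` and a multiple
of `q`, it gives `E[exp (t L)] E[exp (-t L)] ≤ exp (t² ‖v‖² / k)`, while the left-hand side is at
least `1 + t² Var L`; letting `t` tend to `0` gives `Var L ≤ ‖v‖² / k`. The Prékopa–Leindler
inequality itself is obtained from the one-dimensional Brunn–Minkowski inequality and the layer-cake
formula on `ℝ` (`prekopaLeindler_real`), and by induction on the dimension through
`PrekopaLeindler.prod`.

The bound `R²` is Popoviciu's inequality in each direction, as the posterior law is carried by the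
support of `P`. The posterior law is a version of the conditional law by Bayes' formula
(`condDistrib_add_smul_ae_eq_gaussianPosterior`), which turns the bound at every `y` into the bound
for the regular conditional law at almost every `y`.
-/

open scoped RealInnerProductSpace

/-! ### The Prékopa–Leindler inequality -/

/-- One-dimensional Brunn–Minkowski inequality for compact sets: the translates `A + min B` and
`max A + B` both lie in `A + B` and meet in a single point. -/
theorem volume_add_volume_le_of_isCompact {A B C : Set ℝ} (hA : IsCompact A) (hB : IsCompact B)
    (hA0 : A.Nonempty) (hB0 : B.Nonempty) (hC : ∀ a ∈ A, ∀ b ∈ B, a + b ∈ C) :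
    volume A + volume B ≤ volume C := by
  obtain ⟨a, haA, ha⟩ := hA.exists_isGreatest hA0
  obtain ⟨b, hbB, hb⟩ := hB.exists_isLeast hB0
  have h1 : volume ((fun x => x + b) '' A) = volume A := by
    rw [Set.image_add_right, measure_preimage_add_right]
  have h2 : volume ((fun x => a + x) '' B) = volume B := by
    rw [Set.image_add_left, measure_preimage_add]
  have hdisj : AEDisjoint volume ((fun x => x + b) '' A) ((fun x => a + x) '' B) := by
    refine measure_mono_null (t := {a + b}) ?_ (by simp)
    rintro z ⟨⟨x, hx, rfl⟩, ⟨y, hy, hxy⟩⟩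
    have := ha hx
    have := hb hy
    simp only [Set.mem_singleton_iff] at *
    linarith
  have hm : MeasurableSet ((fun x => a + x) '' B) :=
    (hB.image (by fun_prop)).measurableSet
  rw [← h1, ← h2, ← measure_union₀ hm.nullMeasurableSet hdisj]
  refine measure_mono (Set.union_subset ?_ ?_)
  · rintro _ ⟨x, hx, rfl⟩
    exact hC x hx b hbB
  · rintro _ ⟨x, hx, rfl⟩
    exact hC a haA x hx

theorem volume_add_volume_le {A B C : Set ℝ} (hA : MeasurableSet A) (hB : MeasurableSet B)
    (hA0 : A.Nonempty) (hB0 : B.Nonempty) (hC : ∀ a ∈ A, ∀ b ∈ B, a + b ∈ C) :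
    volume A + volume B ≤ volume C := by
  obtain ⟨a, ha⟩ := hA0
  obtain ⟨b, hb⟩ := hB0
  rw [hA.measure_eq_iSup_isCompact, hB.measure_eq_iSup_isCompact]
  simp_rw [iSup_and']
  refine ENNReal.biSup_add_biSup_le' ⟨∅, by simp⟩ ⟨∅, by simp⟩ fun K hK L hL => ?_
  -- The sets are enlarged by a point since inner approximations of a null set may be empty.
  calc volume K + volume L ≤ volume (insert a K) + volume (insert b L) := by
        gcongr <;> exact Set.subset_insert _ _
    _ ≤ volume C := volume_add_volume_le_of_isCompact (hK.2.insert a) (hL.2.insert b)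
        (Set.insert_nonempty _ _) (Set.insert_nonempty _ _) fun x hx y hy =>
          hC x (Set.insert_subset ha hK.1 hx) y (Set.insert_subset hb hL.1 hy)

theorem ENNReal.mul_le_sq_of_add_le_two_mul {a b c : ENNReal} (h : a + b ≤ 2 * c) :
    a * b ≤ c ^ 2 := by
  rcases eq_or_ne c ⊤ with rfl | hc
  · simp
  have h2c : 2 * c ≠ ⊤ := ENNReal.mul_ne_top (by simp) hc
  have ha : a ≠ ⊤ := ne_top_of_le_ne_top h2c (le_self_add.trans h)
  have hb : b ≠ ⊤ := ne_top_of_le_ne_top h2c (le_add_self.trans h)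
  lift a to NNReal using ha
  lift b to NNReal using hb
  lift c to NNReal using hc
  norm_cast at h ⊢
  rw [← NNReal.coe_le_coe] at h ⊢
  push_cast at h ⊢
  nlinarith [sq_nonneg ((a : ℝ) - b), a.2, b.2, c.2]

/-- If `f` and `g` have supremum `1`, then for `0 < t < 1` the superlevel sets `{t < f}` and
`{t < g}` are nonempty and their Minkowski average lies in `{t < h}`. Integrating the
one-dimensional Brunn–Minkowski inequality over `t` gives an arithmetic-mean form of the
Prékopa–Leindler inequality. -/
theorem lintegral_add_lintegral_le_of_sup_eq_one {f g h : ℝ → ℝ} (hf : Measurable f)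
    (hg : Measurable g) (hh : Measurable h) (f0 : 0 ≤ f) (g0 : 0 ≤ g) (h0 : 0 ≤ h)
    (f1 : ∀ x, f x ≤ 1) (g1 : ∀ x, g x ≤ 1)
    (fs : ∀ t < 1, ∃ x, t < f x) (gs : ∀ t < 1, ∃ x, t < g x)
    (H : ∀ x y, f x * g y ≤ h ((1 / 2 : ℝ) • (x + y)) ^ 2) :
    (∫⁻ x, ENNReal.ofReal (f x)) + (∫⁻ x, ENNReal.ofReal (g x)) ≤
      2 * ∫⁻ x, ENNReal.ofReal (h x) := by
  rw [lintegral_eq_lintegral_meas_lt _ (.of_forall f0) hf.aemeasurable,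
    lintegral_eq_lintegral_meas_lt _ (.of_forall g0) hg.aemeasurable,
    lintegral_eq_lintegral_meas_lt _ (.of_forall h0) hh.aemeasurable]
  have hmono : ∀ φ : ℝ → ℝ, Measurable fun t : ℝ => volume {x | t < φ x} := fun φ =>
    Antitone.measurable fun s t hst => measure_mono fun x (hx : t < φ x) => hst.trans_lt hx
  rw [← lintegral_add_left (hmono f), ← lintegral_const_mul _ (hmono h)]
  refine setLIntegral_mono ((hmono h).const_mul _) fun t ht => ?_
  rcases lt_or_ge t 1 with ht1 | ht1
  · have hscale : volume ((fun x : ℝ => 2 * x) '' {x | t < h x}) = 2 * volume {x | t < h x} := by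
      have := Measure.addHaar_smul (volume : Measure ℝ) 2 {x | t < h x}
      simpa [← Set.image_smul] using this
    rw [← hscale]
    refine volume_add_volume_le (measurableSet_lt measurable_const hf)
      (measurableSet_lt measurable_const hg) (fs t ht1) (gs t ht1) fun x hx y hy => ?_
    refine ⟨(1 / 2 : ℝ) • (x + y), ?_, by simp⟩
    refine lt_of_pow_lt_pow_left₀ 2 (h0 _) (lt_of_lt_of_le ?_ (H x y))
    rw [sq]
    exact mul_lt_mul'' hx hy (le_of_lt ht) (le_of_lt ht)
  · have e1 : {x | t < f x} = ∅ := by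
      ext x; simpa using (f1 x).trans ht1
    have e2 : {x | t < g x} = ∅ := by
      ext x; simpa using (g1 x).trans ht1
    simp [e1, e2]

theorem exists_lt_div_ciSup {f : ℝ → ℝ} (hpos : 0 < ⨆ x, f x)
    {t : ℝ} (ht : t < 1) : ∃ x, t < f x / ⨆ x, f x := by
  obtain ⟨x, hx⟩ := exists_lt_of_lt_ciSup (f := f) (b := t * ⨆ x, f x) (by nlinarith)
  exact ⟨x, by rwa [lt_div_iff₀ hpos]⟩

/-- Bounded functions are normalized to have supremum `1`; the arithmetic-mean inequality for the
normalized functions then implies the geometric-mean one. -/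
theorem prekopa_leindler_real_of_bddAbove {f g h : ℝ → ℝ} (hf : Measurable f)
    (hg : Measurable g) (hh : Measurable h) (f0 : 0 ≤ f) (g0 : 0 ≤ g) (h0 : 0 ≤ h)
    (fb : BddAbove (Set.range f)) (gb : BddAbove (Set.range g))
    (H : ∀ x y, f x * g y ≤ h ((1 / 2 : ℝ) • (x + y)) ^ 2) :
    (∫⁻ x, ENNReal.ofReal (f x)) * (∫⁻ x, ENNReal.ofReal (g x)) ≤
      (∫⁻ x, ENNReal.ofReal (h x)) ^ 2 := by
  set F := ⨆ x, f x with hF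
  set G := ⨆ x, g x with hG
  have hfF : ∀ x, f x ≤ F := le_ciSup fb
  have hgG : ∀ x, g x ≤ G := le_ciSup gb
  rcases (Real.iSup_nonneg f0).eq_or_lt with hF0 | hF0
  · have : f = 0 := funext fun x => le_antisymm ((hfF x).trans hF0.ge) (f0 x)
    simp [this]
  rcases (Real.iSup_nonneg g0).eq_or_lt with hG0 | hG0
  · have : g = 0 := funext fun x => le_antisymm ((hgG x).trans hG0.ge) (g0 x)
    simp [this]
  change 0 < F at hF0
  change 0 < G at hG0
  have hs : 0 < √(F * G) := Real.sqrt_pos.2 (mul_pos hF0 hG0)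
  have key := ENNReal.mul_le_sq_of_add_le_two_mul
    (lintegral_add_lintegral_le_of_sup_eq_one (f := fun x => f x / F) (g := fun x => g x / G)
      (h := fun x => h x / √(F * G)) (hf.div_const _) (hg.div_const _) (hh.div_const _)
      (fun x => div_nonneg (f0 x) hF0.le) (fun x => div_nonneg (g0 x) hG0.le)
      (fun x => div_nonneg (h0 x) hs.le)
      (fun x => (div_le_one hF0).2 (hfF x)) (fun x => (div_le_one hG0).2 (hgG x))
      (fun t ht => exists_lt_div_ciSup hF0 ht) (fun t ht => exists_lt_div_ciSup hG0 ht)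
      (fun x y => by
        rw [div_mul_div_comm, div_pow, Real.sq_sqrt (mul_pos hF0 hG0).le]
        exact div_le_div_of_nonneg_right (H x y) (mul_pos hF0 hG0).le))
  have scale : ∀ {φ : ℝ → ℝ} {c : ℝ}, 0 < c → Measurable φ →
      ∫⁻ x, ENNReal.ofReal (φ x) = ENNReal.ofReal c * ∫⁻ x, ENNReal.ofReal (φ x / c) := by
    intro φ c hc hφ
    rw [← lintegral_const_mul _ (by fun_prop)]
    refine lintegral_congr fun x => ?_
    rw [← ENNReal.ofReal_mul hc.le, mul_div_cancel₀ _ hc.ne']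
  rw [scale hF0 hf, scale hG0 hg, scale hs hh, mul_mul_mul_comm, mul_pow,
    ← ENNReal.ofReal_mul hF0.le, ← ENNReal.ofReal_pow hs.le, Real.sq_sqrt (mul_pos hF0 hG0).le]
  gcongr

/-- The Prékopa–Leindler inequality with weights `1/2`, as a property of a measure: whenever `h` at
each midpoint is at least the geometric mean of `f` and `g` at the end points, its integral is at
least the geometric mean of their integrals. Functions take values in `[0, ∞]`, so that the property
passes to products without integrability assumptions, and square roots are avoided by squaring. -/
def PrekopaLeindler {E : Type*} [AddCommGroup E] [Module ℝ E] [MeasurableSpace E]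
    (μ : Measure E) : Prop :=
  ∀ ⦃f g h : E → ENNReal⦄, Measurable f → Measurable g → Measurable h →
    (∀ x y, f x * g y ≤ h ((1 / 2 : ℝ) • (x + y)) ^ 2) →
    (∫⁻ x, f x ∂μ) * (∫⁻ x, g x ∂μ) ≤ (∫⁻ x, h x ∂μ) ^ 2

theorem lintegral_eq_iSup_min_natCast {α : Type*} [MeasurableSpace α] {μ : Measure α}
    {f : α → ENNReal} (hf : Measurable f) :
    ∫⁻ x, f x ∂μ = ⨆ n : ℕ, ∫⁻ x, min (f x) n ∂μ := by
  rw [← lintegral_iSup (fun n => hf.min measurable_const)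
    (fun m n hmn x => min_le_min_left _ (by exact_mod_cast hmn))]
  refine lintegral_congr fun x => ?_
  have := ENNReal.iSup_natCast
  rw [← inf_iSup_eq, this, inf_top_eq]

theorem prekopaLeindler_real : PrekopaLeindler (volume : Measure ℝ) := by
  intro f g h hf hg hh H
  -- All three functions are truncated at height `n`; the hypothesis survives the truncation.
  have bound : ∀ n : ℕ,
      (∫⁻ x, min (f x) n) * (∫⁻ x, min (g x) n) ≤ (∫⁻ x, h x) ^ 2 := by
    intro n
    have hne : ∀ (φ : ℝ → ENNReal) x, min (φ x) (n : ENNReal) ≠ ⊤ := fun φ x =>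
      ne_top_of_le_ne_top (ENNReal.natCast_ne_top n) (min_le_right _ _)
    have hbdd : ∀ φ : ℝ → ENNReal,
        BddAbove (Set.range fun x => (min (φ x) (n : ENNReal)).toReal) := by
      intro φ
      refine ⟨n, ?_⟩
      rintro _ ⟨x, rfl⟩
      exact ENNReal.toReal_le_of_le_ofReal (Nat.cast_nonneg n) (by simp)
    have key := prekopa_leindler_real_of_bddAbove
      (f := fun x => (min (f x) (n : ENNReal)).toReal)
      (g := fun x => (min (g x) (n : ENNReal)).toReal)
      (h := fun x => (min (h x) (n : ENNReal)).toReal)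
      (hf.min measurable_const).ennreal_toReal (hg.min measurable_const).ennreal_toReal
      (hh.min measurable_const).ennreal_toReal (fun _ => ENNReal.toReal_nonneg)
      (fun _ => ENNReal.toReal_nonneg) (fun _ => ENNReal.toReal_nonneg) (hbdd f) (hbdd g) ?_
    · simp only [ENNReal.ofReal_toReal (hne _ _)] at key
      refine key.trans ?_
      gcongr
      exact min_le_left _ _
    · intro x y
      rw [← ENNReal.toReal_mul, ← ENNReal.toReal_pow]
      refine ENNReal.toReal_mono (ENNReal.pow_ne_top (hne _ _)) ?_
      rcases min_choice (h ((1 / 2 : ℝ) • (x + y))) (n : ENNReal) with e | e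
      · rw [e]
        exact (mul_le_mul' (min_le_left _ _) (min_le_left _ _)).trans (H x y)
      · rw [e, sq]
        exact mul_le_mul' (min_le_right _ _) (min_le_right _ _)
  have mono : ∀ φ : ℝ → ENNReal, Monotone fun n : ℕ => ∫⁻ x, min (φ x) n := fun φ m n hmn =>
    lintegral_mono fun x => min_le_min_left _ (by exact_mod_cast hmn)
  rw [lintegral_eq_iSup_min_natCast hf, lintegral_eq_iSup_min_natCast hg, ENNReal.iSup_mul]
  refine iSup_le fun m => ?_
  rw [ENNReal.mul_iSup]
  exact iSup_le fun n => (mul_le_mul' (mono f (le_max_left m n))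
    (mono g (le_max_right m n))).trans (bound _)

/-- The inequality on `F`, applied to sections, shows that the partial integrals satisfy the
hypothesis of the inequality on `E`. -/
theorem PrekopaLeindler.prod {E F : Type*} [AddCommGroup E] [Module ℝ E] [MeasurableSpace E]
    [AddCommGroup F] [Module ℝ F] [MeasurableSpace F] {μ : Measure E} {ν : Measure F}
    [SFinite ν] (hμ : PrekopaLeindler μ) (hν : PrekopaLeindler ν) :
    PrekopaLeindler (μ.prod ν) := by
  intro f g h hf hg hh H
  rw [lintegral_prod _ hf.aemeasurable, lintegral_prod _ hg.aemeasurable,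
    lintegral_prod _ hh.aemeasurable]
  refine hμ hf.lintegral_prod_right' hg.lintegral_prod_right' hh.lintegral_prod_right'
    fun x y => ?_
  exact hν (hf.comp measurable_prodMk_left) (hg.comp measurable_prodMk_left)
    (hh.comp measurable_prodMk_left) fun u v => by simpa using H (x, u) (y, v)

theorem PrekopaLeindler.of_measurePreserving {E F : Type*} [AddCommGroup E] [Module ℝ E]
    [MeasurableSpace E] [AddCommGroup F] [Module ℝ F] [MeasurableSpace F] {μ : Measure E}
    {ν : Measure F} (hμ : PrekopaLeindler μ) {T : E → F} (hT : MeasurePreserving T μ ν)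
    (hmid : ∀ x y, T ((1 / 2 : ℝ) • (x + y)) = (1 / 2 : ℝ) • (T x + T y)) :
    PrekopaLeindler ν := by
  intro f g h hf hg hh H
  rw [← hT.lintegral_comp hf, ← hT.lintegral_comp hg, ← hT.lintegral_comp hh]
  refine hμ (hf.comp hT.measurable) (hg.comp hT.measurable) (hh.comp hT.measurable) fun x y => ?_
  simpa only [Function.comp_apply, hmid] using H (T x) (T y)

theorem prekopaLeindler_pi (n : ℕ) : PrekopaLeindler (volume : Measure (Fin n → ℝ)) := by
  induction n with
  | zero =>
    intro f g h hf hg hh H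
    simp only [volume_pi, Measure.pi_of_empty _ (0 : Fin 0 → ℝ), lintegral_dirac]
    simpa using H 0 0
  | succ n ih =>
    refine (prekopaLeindler_real.prod ih).of_measurePreserving
      (volume_preserving_piFinSuccAbove (fun _ : Fin (n + 1) => ℝ) 0).symm fun x y => ?_
    ext i
    refine Fin.cases ?_ (fun j => ?_) i <;> simp [MeasurableEquiv.piFinSuccAbove, mul_add]

theorem prekopaLeindler_euclideanSpace (n : ℕ) :
    PrekopaLeindler (volume : Measure (EuclideanSpace ℝ (Fin n))) :=
  (prekopaLeindler_pi n).of_measurePreserving (PiLp.volume_preserving_toLp (Fin n))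
    fun _ _ => rfl

/-! ### Variance of linear functionals of strongly log-concave laws -/

theorem two_add_sq_le_exp_add_exp_neg (s : ℝ) : 2 + s ^ 2 ≤ Real.exp s + Real.exp (-s) := by
  have h1 : Real.exp s + Real.exp (-s) = 2 * Real.cosh s := by rw [Real.cosh_eq]; ring
  have h2 : Real.cosh s = 1 + 2 * Real.sinh (s / 2) ^ 2 := by
    have := Real.cosh_two_mul (s / 2)
    rw [mul_div_cancel₀ _ two_ne_zero] at this
    rw [this, Real.cosh_sq]; ring
  have h3 : (s / 2) ^ 2 ≤ Real.sinh (s / 2) ^ 2 := by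
    rcases le_total 0 (s / 2) with h | h
    · exact pow_le_pow_left₀ h (Real.self_le_sinh_iff.2 h) 2
    · have := Real.sinh_le_self_iff.2 h
      nlinarith
  rw [h1, h2]
  linarith

/-- The product of moment generating functions is the integral of `cosh (t (L x - L y))` against
`μ ⊗ μ`, and `cosh s ≥ 1 + s² / 2`. -/
theorem one_add_sq_mul_variance_le_mgf_mul_mgf_neg {Ω : Type*} [MeasurableSpace Ω]
    {μ : Measure Ω} [IsProbabilityMeasure μ] {L : Ω → ℝ} (hL : MemLp L 2 μ) {t : ℝ}
    (h1 : Integrable (fun x => Real.exp (t * L x)) μ)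
    (h2 : Integrable (fun x => Real.exp (-t * L x)) μ) :
    1 + t ^ 2 * Var[L; μ] ≤ mgf L μ t * mgf L μ (-t) := by
  have i1 : Integrable (fun z : Ω × Ω => Real.exp (t * (L z.1 - L z.2))) (μ.prod μ) := by
    refine (h1.mul_prod h2).congr (.of_forall fun z => ?_)
    simp only [← Real.exp_add]
    ring_nf
  have i2 : Integrable (fun z : Ω × Ω => Real.exp (-(t * (L z.1 - L z.2)))) (μ.prod μ) := by
    refine (h2.mul_prod h1).congr (.of_forall fun z => ?_)
    simp only [← Real.exp_add]
    ring_nf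
  have e1 : ∫ z : Ω × Ω, Real.exp (t * (L z.1 - L z.2)) ∂(μ.prod μ) =
      mgf L μ t * mgf L μ (-t) := by
    rw [mgf, mgf, ← integral_prod_mul]
    refine integral_congr_ae (.of_forall fun z => ?_)
    simp only [← Real.exp_add]
    ring_nf
  have e2 : ∫ z : Ω × Ω, Real.exp (-(t * (L z.1 - L z.2))) ∂(μ.prod μ) =
      mgf L μ t * mgf L μ (-t) := by
    rw [mul_comm, mgf, mgf, ← integral_prod_mul]
    refine integral_congr_ae (.of_forall fun z => ?_)
    simp only [← Real.exp_add]
    ring_nf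
  have m1 : MemLp (fun z : Ω × Ω => L z.1) 2 (μ.prod μ) := hL.comp_fst μ
  have m2 : MemLp (fun z : Ω × Ω => L z.2) 2 (μ.prod μ) := hL.comp_snd μ
  have hsq : Integrable (fun z : Ω × Ω => (L z.1 - L z.2) ^ 2) (μ.prod μ) :=
    (m1.sub m2).integrable_sq
  have e3 : ∫ z : Ω × Ω, (L z.1 - L z.2) ^ 2 ∂(μ.prod μ) = 2 * Var[L; μ] := by
    have hv := variance_eq_sub (m1.sub m2)
    have hm : ∫ z : Ω × Ω, (L z.1 - L z.2) ∂(μ.prod μ) = 0 := by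
      rw [integral_sub (m1.integrable one_le_two) (m2.integrable one_le_two), integral_fun_fst,
        integral_fun_snd, sub_self]
    have hv2 := variance_add_prod hL hL.neg
    rw [variance_neg] at hv2
    simp only [Pi.sub_def, Pi.pow_apply, hm, Pi.neg_apply, ← sub_eq_add_neg] at hv hv2
    linarith
  have := integral_mono (f := fun z : Ω × Ω => 2 + t ^ 2 * (L z.1 - L z.2) ^ 2)
    ((integrable_const _).add (hsq.const_mul _)) (i1.add i2)
    (fun z => by simpa [mul_pow] using two_add_sq_le_exp_add_exp_neg (t * (L z.1 - L z.2)))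
  rw [integral_add (integrable_const _) (hsq.const_mul _), integral_const_mul, e3,
    integral_add' i1 i2, e1, e2] at this
  simp at this
  linarith

theorem le_of_forall_one_add_sq_mul_le_exp {V s : ℝ} (hV : 0 ≤ V) (hs : 0 ≤ s)
    (h : ∀ t : ℝ, 1 + t ^ 2 * V ≤ Real.exp (t ^ 2 * s)) : V ≤ s := by
  by_contra! hlt
  -- Since `exp (u s) ≤ 1 / (1 - u s)`, the hypothesis at `t² = u` gives `V - s ≤ u V s`, which
  -- fails for small `u`.
  obtain ⟨u, hu0, hu1, hu2⟩ : ∃ u : ℝ, 0 < u ∧ u * (V * s) < V - s ∧ u * s < 1 := by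
    have hd : 0 < (V - s) / (V * s + 1) := div_pos (by linarith) (by positivity)
    refine ⟨min ((V - s) / (V * s + 1)) (1 / (s + 1)), lt_min hd (by positivity), ?_, ?_⟩
    · calc _ ≤ (V - s) / (V * s + 1) * (V * s) := by gcongr; exact min_le_left _ _
        _ < (V - s) / (V * s + 1) * (V * s + 1) := by gcongr; linarith
        _ = V - s := div_mul_cancel₀ _ (by positivity)
    · calc _ ≤ 1 / (s + 1) * s := by gcongr; exact min_le_right _ _
        _ < 1 / (s + 1) * (s + 1) := by gcongr; linarith
        _ = 1 := div_mul_cancel₀ _ (by positivity)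
  have h1 := h √u
  rw [Real.sq_sqrt hu0.le] at h1
  have h2 : 1 - u * s ≤ Real.exp (-(u * s)) := by linarith [Real.add_one_le_exp (-(u * s))]
  have h3 : (1 + u * V) * (1 - u * s) ≤ 1 := by
    calc _ ≤ Real.exp (u * s) * Real.exp (-(u * s)) :=
          mul_le_mul h1 h2 (by linarith) (Real.exp_pos _).le
      _ = 1 := by rw [← Real.exp_add]; simp
  nlinarith [mul_pos hu0 (sub_pos.2 hu1)]

/-- The Brascamp–Lieb inequality for linear functionals: the variance of `⟪v, ·⟫` under a law whose
density is `k`-strongly log-concave at midpoints is at most `‖v‖² / k`. The Prékopa–Leindler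
inequality, applied to the two exponential tilts of the density by `± t ⟪v, ·⟫`, bounds the product
of moment generating functions at `t` and `-t` by `exp (t² ‖v‖² / k)`. -/
theorem variance_inner_le_of_strongly_logConcave {D : ℕ}
    {ν : Measure (EuclideanSpace ℝ (Fin D))} [IsProbabilityMeasure ν]
    {q : EuclideanSpace ℝ (Fin D) → ℝ} (hq : Measurable q) (q0 : ∀ x, 0 ≤ q x)
    (hν : ν = volume.withDensity fun x => ENNReal.ofReal (q x)) {k : ℝ} (hk : 0 < k)
    (hlc : ∀ x y, q x * q y ≤ q ((1 / 2 : ℝ) • (x + y)) ^ 2 * Real.exp (-(k / 4) * ‖x - y‖ ^ 2))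
    (v : EuclideanSpace ℝ (Fin D)) {C : ℝ} (hC : ∀ᵐ x ∂ν, |⟪v, x⟫| ≤ C) :
    Var[fun x => ⟪v, x⟫; ν] ≤ ‖v‖ ^ 2 / k := by
  have hLm : Measurable fun x : EuclideanSpace ℝ (Fin D) => ⟪v, x⟫ := by fun_prop
  have hmem : MemLp (fun x => ⟪v, x⟫) 2 ν := .of_bound hLm.aestronglyMeasurable C hC
  have hint : ∀ t : ℝ, Integrable (fun x => Real.exp (t * ⟪v, x⟫)) ν := by
    intro t
    refine .of_bound (by fun_prop) (Real.exp (|t| * C)) ?_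
    filter_upwards [hC] with x hx
    rw [Real.norm_eq_abs, Real.abs_exp, Real.exp_le_exp]
    exact (le_abs_self _).trans (by rw [abs_mul]; gcongr)
  have hmgf : ∀ t : ℝ, ENNReal.ofReal (mgf (fun x => ⟪v, x⟫) ν t) =
      ∫⁻ x, ENNReal.ofReal (q x * Real.exp (t * ⟪v, x⟫)) := by
    intro t
    rw [mgf, ofReal_integral_eq_lintegral_ofReal (hint t) (.of_forall fun x => (Real.exp_pos _).le),
      hν, lintegral_withDensity_eq_lintegral_mul _ (by fun_prop) (by fun_prop)]
    refine lintegral_congr fun x => ?_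
    rw [Pi.mul_apply, ← ENNReal.ofReal_mul (q0 x)]
  refine le_of_forall_one_add_sq_mul_le_exp (variance_nonneg _ _) (by positivity) fun t => ?_
  refine (one_add_sq_mul_variance_le_mgf_mul_mgf_neg hmem (hint t) (hint (-t))).trans ?_
  have hPL := prekopaLeindler_euclideanSpace D
    (f := fun x => ENNReal.ofReal (q x * Real.exp (t * ⟪v, x⟫)))
    (g := fun x => ENNReal.ofReal (q x * Real.exp (-t * ⟪v, x⟫)))
    (h := fun x => ENNReal.ofReal (q x * Real.exp (t ^ 2 * (‖v‖ ^ 2 / k) / 2)))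
    (by fun_prop) (by fun_prop) (by fun_prop) ?_
  · have hone : ∫⁻ x, ENNReal.ofReal (q x) = 1 := by
      rw [← setLIntegral_univ, ← withDensity_apply _ .univ, ← hν, measure_univ]
    simp_rw [ENNReal.ofReal_mul (q0 _)] at hPL
    rw [lintegral_mul_const _ (by fun_prop : Measurable fun x => ENNReal.ofReal (q x)), hone,
      one_mul, ← ENNReal.ofReal_pow (Real.exp_pos _).le, ← Real.exp_nat_mul] at hPL
    simp_rw [← ENNReal.ofReal_mul (q0 _)] at hPL
    rw [← hmgf, ← hmgf, ← ENNReal.ofReal_mul mgf_nonneg,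
      ENNReal.ofReal_le_ofReal_iff (Real.exp_pos _).le] at hPL
    refine hPL.trans_eq ?_
    congr 1
    push_cast
    ring
  · intro x y
    rw [← ENNReal.ofReal_mul (mul_nonneg (q0 _) (Real.exp_pos _).le), ← ENNReal.ofReal_pow
      (mul_nonneg (q0 _) (Real.exp_pos _).le)]
    refine ENNReal.ofReal_le_ofReal ?_
    calc q x * Real.exp (t * ⟪v, x⟫) * (q y * Real.exp (-t * ⟪v, y⟫))
        = q x * q y * Real.exp (t * ⟪v, x - y⟫) := by
          rw [mul_mul_mul_comm, ← Real.exp_add, inner_sub_right]; ring_nf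
      _ ≤ q ((1 / 2 : ℝ) • (x + y)) ^ 2 * Real.exp (-(k / 4) * ‖x - y‖ ^ 2) *
          Real.exp (t * ⟪v, x - y⟫) := by
          exact mul_le_mul_of_nonneg_right (hlc x y) (Real.exp_pos _).le
      _ = q ((1 / 2 : ℝ) • (x + y)) ^ 2 *
          Real.exp (-(k / 4) * ‖x - y‖ ^ 2 + t * ⟪v, x - y⟫) := by rw [mul_assoc, Real.exp_add]
      _ ≤ q ((1 / 2 : ℝ) • (x + y)) ^ 2 * Real.exp (t ^ 2 * (‖v‖ ^ 2 / k)) := by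
          gcongr
          have hin : t * ⟪v, x - y⟫ ≤ |t| * (‖v‖ * ‖x - y‖) := by
            refine (le_abs_self _).trans ?_
            rw [abs_mul]
            gcongr
            exact abs_real_inner_le_norm _ _
          -- Completing the square in `‖x - y‖`.
          have hsq : t ^ 2 * (‖v‖ ^ 2 / k) - |t| * (‖v‖ * ‖x - y‖) + k / 4 * ‖x - y‖ ^ 2 =
              (|t| * ‖v‖ - k / 2 * ‖x - y‖) ^ 2 / k := by
            field_simp
            rw [← sq_abs t]
            ring
          have : 0 ≤ (|t| * ‖v‖ - k / 2 * ‖x - y‖) ^ 2 / k := by positivity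
          linarith
      _ = _ := by
          rw [mul_pow, ← Real.exp_nat_mul]
          congr 2
          push_cast
          ring

/-! ### Covariance of the posterior law -/

theorem covMat_le_smul_one {D : ℕ} {ν : Measure (EuclideanSpace ℝ (Fin D))}
    [IsFiniteMeasure ν] (hmem : ∀ i, MemLp (fun x : EuclideanSpace ℝ (Fin D) => x i) 2 ν) {c : ℝ}
    (h : ∀ v : EuclideanSpace ℝ (Fin D), Var[fun x => ⟪v, x⟫; ν] ≤ c * ‖v‖ ^ 2) :
    covMat ν ≤ c • (1 : Matrix (Fin D) (Fin D) ℝ) := by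
  rw [Matrix.le_iff]
  refine .of_dotProduct_mulVec_nonneg ?_ fun v => ?_
  · refine (Matrix.isHermitian_one.smul (.all c)).sub ?_
    ext i j
    simp [covMat, covariance_comm]
  · have hv := h (WithLp.toLp 2 v)
    have e1 : Var[fun x => ⟪WithLp.toLp 2 v, x⟫; ν] = v ⬝ᵥ (covMat ν).mulVec v := by
      simp only [PiLp.inner_apply, RCLike.inner_apply, conj_trivial]
      rw [variance_fun_sum fun i => (hmem i).mul_const (v i)]
      simp only [covariance_mul_const_left, covariance_mul_const_right, dotProduct,
        Matrix.mulVec, covMat, Matrix.of_apply, Finset.mul_sum]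
      refine Finset.sum_congr rfl fun i _ => Finset.sum_congr rfl fun j _ => by ring
    have e2 : ‖WithLp.toLp 2 v‖ ^ 2 = v ⬝ᵥ v := by
      rw [EuclideanSpace.norm_sq_eq]
      simp [dotProduct, sq]
    rw [e1, e2] at hv
    simpa [Matrix.sub_mulVec, Matrix.smul_mulVec, dotProduct_sub] using hv

/-- Popoviciu's inequality in each direction: `⟪v, ·⟫` maps a set of diameter at most `2 R` into an
interval of length at most `2 R ‖v‖`. -/
theorem variance_inner_le_of_ediam_le {E : Type*} [NormedAddCommGroup E] [InnerProductSpace ℝ E]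
    [MeasurableSpace E] [BorelSpace E] {ν : Measure E}
    [IsProbabilityMeasure ν] {S : Set E} (hS : ∀ᵐ x ∂ν, x ∈ S) {R : ℝ} (hR : 0 ≤ R)
    (hdiam : Metric.ediam S ≤ ENNReal.ofReal (2 * R)) (v : E) :
    Var[fun x => ⟪v, x⟫; ν] ≤ R ^ 2 * ‖v‖ ^ 2 := by
  have hdist : ∀ a ∈ (fun x => ⟪v, x⟫) '' S, ∀ b ∈ (fun x => ⟪v, x⟫) '' S,
      dist a b ≤ 2 * R * ‖v‖ := by
    rintro _ ⟨x, hx, rfl⟩ _ ⟨y, hy, rfl⟩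
    have hxy : dist x y ≤ 2 * R := (edist_le_ofReal (by positivity)).1
      ((Metric.edist_le_ediam_of_mem hx hy).trans hdiam)
    rw [Real.dist_eq, ← inner_sub_right]
    refine (abs_real_inner_le_norm _ _).trans ?_
    rw [mul_comm, ← dist_eq_norm]
    gcongr
  have hbdd : Bornology.IsBounded ((fun x => ⟪v, x⟫) '' S) :=
    Metric.isBounded_iff.2 ⟨_, fun a ha b hb => hdist a ha b hb⟩
  have hle := Metric.diam_le_of_forall_dist_le (by positivity) hdist
  rw [Real.diam_eq hbdd] at hle
  have hvar : Var[fun x => ⟪v, x⟫; ν] ≤ ((sSup ((fun x => ⟪v, x⟫) '' S) -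
      sInf ((fun x => ⟪v, x⟫) '' S)) / 2) ^ 2 := by
    refine variance_le_sq_of_bounded ?_ (by fun_prop)
    filter_upwards [hS] with x hx
    exact ⟨csInf_le hbdd.bddBelow ⟨x, hx, rfl⟩, le_csSup hbdd.bddAbove ⟨x, hx, rfl⟩⟩
  have hnonneg := Real.sInf_le_sSup _ hbdd.bddBelow hbdd.bddAbove
  refine hvar.trans ?_
  rw [← mul_pow]
  exact pow_le_pow_left₀ (by linarith) (by linarith) 2

theorem integrable_gaussianWeight {E : Type*} [NormedAddCommGroup E] [MeasurableSpace E]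
    [BorelSpace E] [SecondCountableTopology E] (P : Measure E) [IsFiniteMeasure P] (σ : ℝ) (y : E) :
    Integrable (fun x => Real.exp (-‖y - x‖ ^ 2 / (2 * σ ^ 2))) P := by
  refine .of_bound (by fun_prop) 1 (.of_forall fun x => ?_)
  rw [Real.norm_eq_abs, Real.abs_exp, Real.exp_le_one_iff, neg_div]
  exact neg_nonpos.2 (by positivity)

section Posterior

variable {D : ℕ} {P : Measure (EuclideanSpace ℝ (Fin D))}

instance isProbabilityMeasure_gaussianPosterior [IsProbabilityMeasure P] (σ : ℝ)
    (y : EuclideanSpace ℝ (Fin D)) : IsProbabilityMeasure (gaussianPosterior P σ y) :=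
  isProbabilityMeasure_tilted (integrable_gaussianWeight P σ y)

theorem gaussianPosterior_eq_withDensity {p : EuclideanSpace ℝ (Fin D) → ℝ} (hp : Measurable p)
    (p0 : ∀ x, 0 ≤ p x) (hP : P = volume.withDensity fun x => ENNReal.ofReal (p x)) (σ : ℝ)
    (y : EuclideanSpace ℝ (Fin D)) :
    gaussianPosterior P σ y = volume.withDensity fun x =>
      ENNReal.ofReal (p x * (Real.exp (-‖y - x‖ ^ 2 / (2 * σ ^ 2)) /
        ∫ x, Real.exp (-‖y - x‖ ^ 2 / (2 * σ ^ 2)) ∂P)) := by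
  rw [gaussianPosterior, Measure.tilted]
  generalize ∫ x, Real.exp (-‖y - x‖ ^ 2 / (2 * σ ^ 2)) ∂P = Z
  rw [hP, ← withDensity_mul _ (by fun_prop) (by fun_prop)]
  refine congrArg _ (funext fun x => ?_)
  rw [Pi.mul_apply, ENNReal.ofReal_mul (p0 x)]

/-- Convexity of `-log p + (M / 2) ‖·‖²` at midpoints, with the logarithms removed by means of the
parallelogram law; the inequality is trivial where `p` vanishes. -/
theorem IsSemiLogConcave.mul_le {M : ℝ} {p : EuclideanSpace ℝ (Fin D) → ℝ}
    (hM : IsSemiLogConcave M p) (x z : EuclideanSpace ℝ (Fin D)) :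
    p x * p z ≤ p ((1 / 2 : ℝ) • (x + z)) ^ 2 * Real.exp (M / 4 * ‖x - z‖ ^ 2) := by
  rcases (hM.nonneg x).eq_or_lt with hx | hx
  · rw [← hx, zero_mul]; positivity
  rcases (hM.nonneg z).eq_or_lt with hz | hz
  · rw [← hz, mul_zero]; positivity
  have hmid : (1 / 2 : ℝ) • x + (1 / 2 : ℝ) • z = (1 / 2 : ℝ) • (x + z) := (smul_add ..).symm
  have hm := hM.convexOn.1 hx hz (by norm_num : (0 : ℝ) ≤ 1 / 2) (by norm_num : (0 : ℝ) ≤ 1 / 2)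
    (by norm_num)
  have hc := hM.convexOn.2 hx hz (by norm_num : (0 : ℝ) ≤ 1 / 2) (by norm_num : (0 : ℝ) ≤ 1 / 2)
    (by norm_num)
  rw [hmid] at hm hc
  have hpar := parallelogram_law_with_norm ℝ x z
  have hn : ‖(1 / 2 : ℝ) • (x + z)‖ ^ 2 = ‖x + z‖ ^ 2 / 4 := by
    rw [norm_smul, mul_pow]; norm_num; ring
  rw [← Real.log_le_log_iff (by positivity) (mul_pos (pow_pos hm 2) (Real.exp_pos _)),
    Real.log_mul hx.ne' hz.ne', Real.log_mul (pow_pos hm 2).ne' (Real.exp_pos _).ne',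
    Real.log_exp, Real.log_pow]
  simp only [hn, smul_eq_mul] at hc
  push_cast
  have : M * ‖x + z‖ ^ 2 = M * (2 * (‖x‖ ^ 2 + ‖z‖ ^ 2) - ‖x - z‖ ^ 2) := by
    rw [← hpar]; ring
  linarith

/-- The Gaussian weight satisfies the midpoint inequality of a `1 / σ²`-strongly log-concave function
with equality, by the parallelogram law. -/
theorem gaussianWeight_mul (σ : ℝ) (y x z : EuclideanSpace ℝ (Fin D)) :
    Real.exp (-‖y - x‖ ^ 2 / (2 * σ ^ 2)) * Real.exp (-‖y - z‖ ^ 2 / (2 * σ ^ 2)) =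
      Real.exp (-‖y - (1 / 2 : ℝ) • (x + z)‖ ^ 2 / (2 * σ ^ 2)) ^ 2 *
        Real.exp (-(1 / σ ^ 2 / 4) * ‖x - z‖ ^ 2) := by
  have hpar := parallelogram_law_with_norm ℝ (y - x) (y - z)
  have hn : ‖(y - x) + (y - z)‖ ^ 2 = 4 * ‖y - (1 / 2 : ℝ) • (x + z)‖ ^ 2 := by
    have : (y - x) + (y - z) = (2 : ℝ) • (y - (1 / 2 : ℝ) • (x + z)) := by module
    rw [this, norm_smul, mul_pow]; norm_num
  have hd : ‖(y - x) - (y - z)‖ = ‖x - z‖ := by rw [sub_sub_sub_cancel_left, norm_sub_rev]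
  rw [hd, hn] at hpar
  rw [← Real.exp_add, ← Real.exp_nat_mul, ← Real.exp_add]
  congr 1
  have h2 : ‖x - z‖ ^ 2 = 2 * (‖y - x‖ ^ 2 + ‖y - z‖ ^ 2) -
      4 * ‖y - (1 / 2 : ℝ) • (x + z)‖ ^ 2 := by linarith
  rw [h2]
  rcases eq_or_ne σ 0 with rfl | hσ
  · simp
  · push_cast
    field_simp
    ring

theorem covMat_gaussianPosterior_le [IsProbabilityMeasure P]
    {p : EuclideanSpace ℝ (Fin D) → ℝ} (hp : Measurable p)
    (hP : P = volume.withDensity (fun x => ENNReal.ofReal (p x)))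
    {M : ℝ} (hM : IsSemiLogConcave M p)
    {R : ℝ} (hR : 0 ≤ R) (hdiam : Metric.ediam P.support ≤ ENNReal.ofReal (2 * R))
    {σ : ℝ} (hσ : 0 < σ) (y : EuclideanSpace ℝ (Fin D)) :
    covMat (gaussianPosterior P σ y) ≤
      semiLogConcaveBound R M σ • (1 : Matrix (Fin D) (Fin D) ℝ) := by
  have hS : ∀ᵐ x ∂gaussianPosterior P σ y, x ∈ P.support :=
    (tilted_absolutelyContinuous P _).ae_le Measure.support_mem_ae
  obtain ⟨C, hC⟩ := (Metric.isBounded_iff_ediam_ne_top.2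
    (ne_top_of_le_ne_top ENNReal.ofReal_ne_top hdiam)).exists_norm_le
  have hb : ∀ᵐ x ∂gaussianPosterior P σ y, ‖x‖ ≤ C := hS.mono fun x hx => hC x hx
  refine covMat_le_smul_one (fun i => .of_bound (by fun_prop) C
    (hb.mono fun x hx => (PiLp.norm_apply_le x i).trans hx)) fun v => ?_
  have hRb := variance_inner_le_of_ediam_le hS hR hdiam v
  rw [semiLogConcaveBound]
  split_ifs with hMσ
  swap
  · exact hRb
  rw [min_mul_of_nonneg _ _ (by positivity)]
  refine le_min hRb ?_
  have hk : 0 < 1 / σ ^ 2 - M := by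
    rw [sub_pos, lt_div_iff₀ (by positivity)]; exact hMσ
  have e : σ ^ 2 / (1 - M * σ ^ 2) * ‖v‖ ^ 2 = ‖v‖ ^ 2 / (1 / σ ^ 2 - M) := by
    have : 1 - M * σ ^ 2 ≠ 0 := by linarith
    have h2 : 1 / σ ^ 2 - M = (1 - M * σ ^ 2) / σ ^ 2 := by field_simp
    rw [h2]
    field_simp
  rw [e]
  refine variance_inner_le_of_strongly_logConcave (by fun_prop)
    (fun x => mul_nonneg (hM.nonneg x) (div_nonneg (Real.exp_pos _).le
      (integral_nonneg fun _ => (Real.exp_pos _).le)))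
    (gaussianPosterior_eq_withDensity hp hM.nonneg hP σ y) hk (fun x z => ?_) v
    (C := ‖v‖ * C) ?_
  · generalize ∫ x, Real.exp (-‖y - x‖ ^ 2 / (2 * σ ^ 2)) ∂P = Z
    have hw := gaussianWeight_mul σ y x z
    have hpz := hM.mul_le x z
    have hsplit : Real.exp (-((1 / σ ^ 2 - M) / 4) * ‖x - z‖ ^ 2) =
        Real.exp (M / 4 * ‖x - z‖ ^ 2) * Real.exp (-(1 / σ ^ 2 / 4) * ‖x - z‖ ^ 2) := by
      rw [← Real.exp_add]; ring_nf
    rw [mul_mul_mul_comm, div_mul_div_comm, hw, hsplit]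
    calc _ ≤ p ((1 / 2 : ℝ) • (x + z)) ^ 2 * Real.exp (M / 4 * ‖x - z‖ ^ 2) * _ :=
          mul_le_mul_of_nonneg_right hpz
            (div_nonneg (by positivity) (mul_self_nonneg Z))
      _ = _ := by ring
  · filter_upwards [hb] with x hx
    exact (abs_real_inner_le_norm _ _).trans (by gcongr)

end Posterior

/-! ### Bayes' formula for the Gaussian channel -/

section Gaussian

variable {E : Type*} [NormedAddCommGroup E] [InnerProductSpace ℝ E] [FiniteDimensional ℝ E]
  [MeasurableSpace E] [BorelSpace E]

/-- The standard Gaussian law has a density proportional to `exp (-‖x‖² / 2)`; the two measures have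
the same characteristic function. The value of the normalizing constant is not needed. -/
theorem stdGaussian_eq_withDensity :
    ∃ c : ENNReal, stdGaussian E =
      volume.withDensity fun x => c * ENNReal.ofReal (Real.exp (-‖x‖ ^ 2 / 2)) := by
  set I : ℝ := ∫ x : E, Real.exp (-‖x‖ ^ 2 / 2) with hI
  have hIc : (I : ℂ) = (Real.pi / (1 / 2 : ℂ)) ^ (Module.finrank ℝ E / 2 : ℂ) := by
    rw [← GaussianFourier.integral_cexp_neg_mul_sq_norm (by norm_num : 0 < (1 / 2 : ℂ).re), hI,
      ← integral_complex_ofReal]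
    refine integral_congr_ae (.of_forall fun x => ?_)
    push_cast
    ring_nf
  have hI0 : I ≠ 0 := by
    intro h
    rw [h, eq_comm] at hIc
    norm_num [Complex.cpow_eq_zero_iff, Real.pi_ne_zero] at hIc
  have hint : Integrable fun x : E => Real.exp (-‖x‖ ^ 2 / 2) := by
    by_contra h
    exact hI0 (integral_undef h)
  have hIpos : 0 < I := lt_of_le_of_ne (integral_nonneg fun _ => (Real.exp_pos _).le) hI0.symm
  refine ⟨ENNReal.ofReal I⁻¹, ?_⟩
  simp_rw [← ENNReal.ofReal_mul (inv_pos.2 hIpos).le]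
  have : IsFiniteMeasure ((volume : Measure E).withDensity fun x =>
      ENNReal.ofReal (I⁻¹ * Real.exp (-‖x‖ ^ 2 / 2))) :=
    isFiniteMeasure_withDensity_ofReal (hint.const_mul _).2
  refine Measure.ext_of_charFun (funext fun t => ?_)
  rw [charFun_stdGaussian, charFun_apply,
    integral_withDensity_eq_integral_toReal_smul (by fun_prop) (.of_forall fun _ => by simp)]
  have key := GaussianFourier.integral_cexp_neg_mul_sq_norm_add
    (by norm_num : 0 < (1 / 2 : ℂ).re) Complex.I t
  rw [← hIc] at key
  have hcongr : ∀ x : E, (ENNReal.ofReal (I⁻¹ * Real.exp (-‖x‖ ^ 2 / 2))).toReal •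
      Complex.exp (⟪x, t⟫ * Complex.I) =
      (I : ℂ)⁻¹ * Complex.exp (-(1 / 2) * ‖x‖ ^ 2 + Complex.I * ⟪t, x⟫) := by
    intro x
    rw [ENNReal.toReal_ofReal (by positivity), Complex.real_smul, Complex.exp_add,
      real_inner_comm]
    push_cast
    ring_nf
  simp_rw [hcongr]
  rw [integral_const_mul, key, ← mul_assoc, inv_mul_cancel₀ (by exact_mod_cast hI0), one_mul,
    Complex.I_sq]
  ring_nf

theorem lintegral_comp_add_smul {G : E → ENNReal} (hG : Measurable G) (x : E) {σ : ℝ}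
    (hσ : σ ≠ 0) :
    ∫⁻ z, G (x + σ • z) = ENNReal.ofReal |(σ ^ Module.finrank ℝ E)⁻¹| * ∫⁻ y, G y := by
  rw [← lintegral_add_left_eq_self G x, ← smul_eq_mul, ← lintegral_smul_measure,
    ← Measure.map_addHaar_smul volume hσ, lintegral_map (by fun_prop) (by fun_prop)]

/-- The law of `x + σ ξ` with `ξ` standard Gaussian has density `c exp (-‖y - x‖² / (2 σ²))`, with a
constant `c` that does not depend on `x`. -/
theorem exists_lintegral_add_smul_stdGaussian {σ : ℝ} (hσ : 0 < σ) :
    ∃ c : ENNReal, ∀ (x : E) (G : E → ENNReal), Measurable G →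
      ∫⁻ z, G (x + σ • z) ∂(stdGaussian E) =
        ∫⁻ y, c * (ENNReal.ofReal (Real.exp (-‖y - x‖ ^ 2 / (2 * σ ^ 2))) * G y) := by
  obtain ⟨c, hc⟩ := stdGaussian_eq_withDensity (E := E)
  refine ⟨c * ENNReal.ofReal |(σ ^ Module.finrank ℝ E)⁻¹|, fun x G hG => ?_⟩
  have hw : Measurable fun y => ENNReal.ofReal (Real.exp (-‖y - x‖ ^ 2 / (2 * σ ^ 2))) * G y := by
    fun_prop
  rw [hc, lintegral_withDensity_eq_lintegral_mul _ (by fun_prop) (by fun_prop),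
    lintegral_const_mul _ hw, mul_assoc, ← lintegral_comp_add_smul hw x hσ.ne',
    ← lintegral_const_mul _ (by fun_prop)]
  refine lintegral_congr fun z => ?_
  rw [Pi.mul_apply, mul_assoc, add_sub_cancel_left, norm_smul, Real.norm_eq_abs, mul_pow, sq_abs,
    ← mul_neg, mul_comm 2 (σ ^ 2), mul_div_mul_left _ _ (by positivity)]

end Gaussian

section Bayes

variable {D : ℕ}

/-- The laws `gaussianPosterior P σ y`, as a kernel in `y`. -/
noncomputable def gaussianPosteriorKernel (P : Measure (EuclideanSpace ℝ (Fin D)))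
    [IsProbabilityMeasure P] (σ : ℝ) :
    Kernel (EuclideanSpace ℝ (Fin D)) (EuclideanSpace ℝ (Fin D)) :=
  (Kernel.const _ P).withDensity fun y x => ENNReal.ofReal
    (Real.exp (-‖y - x‖ ^ 2 / (2 * σ ^ 2)) / ∫ x, Real.exp (-‖y - x‖ ^ 2 / (2 * σ ^ 2)) ∂P)

theorem gaussianPosteriorKernel_apply (P : Measure (EuclideanSpace ℝ (Fin D)))
    [IsProbabilityMeasure P] (σ : ℝ) (y : EuclideanSpace ℝ (Fin D)) :
    gaussianPosteriorKernel P σ y = gaussianPosterior P σ y := by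
  rw [gaussianPosteriorKernel, Kernel.withDensity_apply, Kernel.const_apply]
  · rfl
  · have hw : Measurable fun z : EuclideanSpace ℝ (Fin D) × EuclideanSpace ℝ (Fin D) =>
        Real.exp (-‖z.1 - z.2‖ ^ 2 / (2 * σ ^ 2)) := by fun_prop
    have hZ := hw.stronglyMeasurable.integral_prod_right' (ν := P)
    exact (hw.div (hZ.measurable.comp measurable_fst)).ennreal_ofReal

instance isMarkovKernel_gaussianPosteriorKernel (P : Measure (EuclideanSpace ℝ (Fin D)))
    [IsProbabilityMeasure P] (σ : ℝ) : IsMarkovKernel (gaussianPosteriorKernel P σ) :=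
  ⟨fun y => by rw [gaussianPosteriorKernel_apply]; infer_instance⟩

/-- The posterior law integrates `G` against the normalized weight; multiplying by the normalizing
constant `∫ exp (-‖y - x‖² / (2 σ²)) dP` gives back the unnormalized integral. -/
theorem lintegral_gaussianWeight_mul_lintegral_gaussianPosterior
    (P : Measure (EuclideanSpace ℝ (Fin D))) [IsProbabilityMeasure P] (σ : ℝ)
    (y : EuclideanSpace ℝ (Fin D)) {G : EuclideanSpace ℝ (Fin D) → ENNReal} (hG : Measurable G) :
    (∫⁻ x, ENNReal.ofReal (Real.exp (-‖y - x‖ ^ 2 / (2 * σ ^ 2))) ∂P) *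
      ∫⁻ x, G x ∂(gaussianPosterior P σ y) =
      ∫⁻ x, ENNReal.ofReal (Real.exp (-‖y - x‖ ^ 2 / (2 * σ ^ 2))) * G x ∂P := by
  have hpos := integral_exp_pos (integrable_gaussianWeight P σ y)
  rw [gaussianPosterior, lintegral_tilted, ← ofReal_integral_eq_lintegral_ofReal
    (integrable_gaussianWeight P σ y) (.of_forall fun _ => (Real.exp_pos _).le)]
  generalize ∫ x, Real.exp (-‖y - x‖ ^ 2 / (2 * σ ^ 2)) ∂P = Z at *
  rw [← lintegral_const_mul _ (by fun_prop)]
  refine lintegral_congr fun x => ?_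
  rw [← mul_assoc, ← ENNReal.ofReal_mul hpos.le, mul_div_cancel₀ _ hpos.ne']

/-- Bayes' formula. By Tonelli, `(Y, X)` has the density `c exp (-‖y - x‖² / (2 σ²))` with respect to
`volume ⊗ P`, and this joint law disintegrates along `Y` into the posterior kernel. -/
theorem condDistrib_add_smul_ae_eq_gaussianPosterior {Ω : Type*} [MeasurableSpace Ω]
    {μ : Measure Ω} [IsProbabilityMeasure μ]
    {P : Measure (EuclideanSpace ℝ (Fin D))} [IsProbabilityMeasure P]
    {X ξ : Ω → EuclideanSpace ℝ (Fin D)}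
    (hXξ : HasLaw (fun ω => (X ω, ξ ω)) (P.prod (stdGaussian (EuclideanSpace ℝ (Fin D)))) μ)
    {σ : ℝ} (hσ : 0 < σ) :
    ∀ᵐ y ∂(μ.map (fun ω => X ω + σ • ξ ω)),
      condDistrib X (fun ω => X ω + σ • ξ ω) μ y = gaussianPosterior P σ y := by
  have hX : AEMeasurable X μ := hXξ.aemeasurable.fst
  have hξ : AEMeasurable ξ μ := hXξ.aemeasurable.snd
  obtain ⟨c, hc⟩ := exists_lintegral_add_smul_stdGaussian (E := EuclideanSpace ℝ (Fin D)) hσ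
  have hjoint : ∀ F : EuclideanSpace ℝ (Fin D) × EuclideanSpace ℝ (Fin D) → ENNReal,
      Measurable F → ∫⁻ ω, F (X ω + σ • ξ ω, X ω) ∂μ = ∫⁻ y, c * ∫⁻ x,
        ENNReal.ofReal (Real.exp (-‖y - x‖ ^ 2 / (2 * σ ^ 2))) * F (y, x) ∂P := by
    intro F hF
    have hF' : Measurable fun z : EuclideanSpace ℝ (Fin D) × EuclideanSpace ℝ (Fin D) =>
        F (z.1 + σ • z.2, z.1) := by fun_prop
    have h1 : ∫⁻ ω, F (X ω + σ • ξ ω, X ω) ∂μ =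
        ∫⁻ z, F (z.1 + σ • z.2, z.1) ∂(P.prod (stdGaussian (EuclideanSpace ℝ (Fin D)))) := by
      rw [← hXξ.map_eq, lintegral_map' hF'.aemeasurable hXξ.aemeasurable]
    rw [h1, lintegral_prod _ hF'.aemeasurable]
    simp_rw [fun x => hc x (fun y => F (y, x)) (by fun_prop)]
    rw [lintegral_lintegral_swap (by fun_prop)]
    refine lintegral_congr fun y => ?_
    rw [lintegral_const_mul _ (by fun_prop)]
  have hκ : μ.map (fun ω => (X ω + σ • ξ ω, X ω)) =
      μ.map (fun ω => X ω + σ • ξ ω) ⊗ₘ gaussianPosteriorKernel P σ := by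
    refine Measure.ext_of_lintegral _ fun F hF => ?_
    have hin : Measurable fun y => ∫⁻ x, F (y, x) ∂(gaussianPosteriorKernel P σ y) :=
      hF.lintegral_kernel_prod_right'
    rw [lintegral_map' hF.aemeasurable (by fun_prop), hjoint F hF, Measure.lintegral_compProd hF,
      lintegral_map' hin.aemeasurable (by fun_prop),
      hjoint (fun z => ∫⁻ x, F (z.1, x) ∂(gaussianPosteriorKernel P σ z.1))
        (hin.comp measurable_fst)]
    refine lintegral_congr fun y => ?_
    dsimp only
    rw [gaussianPosteriorKernel_apply,
      ← lintegral_gaussianWeight_mul_lintegral_gaussianPosterior P σ y (by fun_prop),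
      lintegral_mul_const _ (by fun_prop)]
  filter_upwards [condDistrib_ae_eq_of_measure_eq_compProd _ hX hκ] with y hy
  rw [hy, gaussianPosteriorKernel_apply]

end Bayes

/-! ### The conditional covariance bound -/

theorem mainTheorem7 {D : ℕ} {Ω : Type*} [MeasurableSpace Ω]
    (μ : Measure Ω) [IsProbabilityMeasure μ]
    (P : Measure (EuclideanSpace ℝ (Fin D))) [IsProbabilityMeasure P]
    (X ξ : Ω → EuclideanSpace ℝ (Fin D))
    (hXξ : HasLaw (fun ω => (X ω, ξ ω)) (P.prod (stdGaussian (EuclideanSpace ℝ (Fin D)))) μ)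
    (p : EuclideanSpace ℝ (Fin D) → ℝ) (hp : Measurable p)
    (hP : P = volume.withDensity (fun x => ENNReal.ofReal (p x)))
    (M : ℝ) (hM : IsSemiLogConcave M p)
    (R : ℝ) (hR : 0 ≤ R) (hdiam : Metric.ediam P.support ≤ ENNReal.ofReal (2 * R))
    (σ : ℝ) (hσ : 0 < σ) :
    (∀ᵐ y ∂(μ.map (fun ω => X ω + σ • ξ ω)),
      covMat (condDistrib X (fun ω => X ω + σ • ξ ω) μ y) ≤
        semiLogConcaveBound R M σ • (1 : Matrix (Fin D) (Fin D) ℝ)) ∧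
    (∀ᵐ y ∂(μ.map (fun ω => X ω + σ • ξ ω)),
      condDistrib X (fun ω => X ω + σ • ξ ω) μ y = gaussianPosterior P σ y) ∧
    (∀ y : EuclideanSpace ℝ (Fin D),
      covMat (gaussianPosterior P σ y) ≤
        semiLogConcaveBound R M σ • (1 : Matrix (Fin D) (Fin D) ℝ)) := by
  have hlaw := condDistrib_add_smul_ae_eq_gaussianPosterior hXξ hσ
  have hcov := covMat_gaussianPosterior_le hp hP hM hR hdiam hσ
  exact ⟨hlaw.mono fun y hy => hy ▸ hcov y, hlaw, hcov⟩
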